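/- Let $N_R\ge 1$, $N_s\ge 2$, $J\ge 1$ be integers and $P_T,\sigma,\gamma>0$ reals. Let $\Omega$ be a measurable set of directions, $\phi\mapsto p(\phi)\ge 0$ the probability density of the UE direction on $\Omega$, $\int_\Omega p(\phi)\,d\phi=1$, let $\alpha(\phi)>0$ be the path loss in direction $\phi$, and let $G_1(\phi),\dots,G_J(\phi)\ge 0$ be the gains of $J$ beamformers in direction $\phi$ ($p,\alpha,G_j$ measurable), with average $G(\phi)=\frac1J\sum_{j=1}^J G_j(\phi)$. Put $$\eta(\phi)=\frac{2P_TN_RN_s}{\alpha(\phi)\sigma^2}\,G(\phi).$$ For $L\ge 1$ let $F(x\,|\,n_1,n_2,\lambda)$ denote the cumulative distribution function of the noncentral $F$-distribution with $n_1,n_2$ degrees of freedom and noncentrality parameter $\lambda$, i.e. of $\frac{X/n_1}{Y/n_2}$ with $X\sim\chi^2_{n_1}(\lambda)$ and $Y\sim\chi^2_{n_2}$ independent. The miss-detection probability in direction $\phi$ after $L$ slots is $$p_{miss}(\phi)=F\big((N_s-1)\gamma\,\big|\,2N_RL,\;2N_RL(N_s-1),\;L\eta(\phi)\big)$$ (the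 probability that the test statistic $L_G$, for which $(N_s-1)L_G\sim\mathcal F(2N_RL,2N_RL(N_s-1),L\eta(\phi))$, is at most $\gamma$), and the average miss-detection probability is $\bar p_{miss}=\int_\Omega p_{miss}(\phi)\,p(\phi)\,d\phi$. Suppose there are a measurable set $\Omega^-\subset\Omega$ and a real $\eta^-$ such that $\eta(\phi)\le\eta^-$ for all $\phi\in\Omega^-$ and $\int_{\Omega^-}p(\phi)\,d\phi>0$. If $\gamma<\frac{2N_R+\eta^-}{2N_R(N_s-1)}$, then the limit $\lim_{L\to\infty}-\frac1L\log\bar p_{miss}$ exists and $$\lim_{L\to\infty}-\frac1L\log\bar p_{miss}\;\le\; I^*(\eta^-,\gamma),$$ where $$I^*(\eta,\gamma)=\frac{\eta}{2}\left(1-\frac{\gamma v^*}{N_R+\sqrt{N_R^2+\gamma\eta v^*}}\right)+N_R(N_s-1)\log\frac{2N_R(N_s-1)}{v^*}-N_R\log\frac{\gamma v^*}{N_R+\sqrt{N_R^2+\gamma\eta v^*}},$$ $v^*=\frac{x^{*2}-N_R^2}{\eta\gamma}$, and $x^*>0$ is the unique positive solution of $$\frac{\gamma+1}{\eta\gamma}(x^2-N_R^2)-x-N_R-2N_R(N_s-1)=0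 .$$ (For $\eta=0$ these are read by continuity: $x^*=N_R$ and $v^*=\frac{2N_RN_s}{\gamma+1}$.) -/

import Mathlib

noncomputable section

namespace BSDiscovery

open MeasureTheory ProbabilityTheory

/-! ### The noncentral chi-square and F distributions -/

/-- The noncentral chi-square distribution with `n` degrees of freedom and noncentrality
parameter `lam ≥ 0`: the law of `∑ i, Z i ^ 2`, where the `Z i` are independent normal variables
of variance one whose means `m i` satisfy `∑ i, m i ^ 2 = lam`. The law depends on the means only
through `lam`; they are taken to be equal here. -/
def noncentralChiSq (n : ℕ) (lam : ℝ) : Measure ℝ :=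
  (Measure.pi fun _ : Fin n => gaussianReal (Real.sqrt (lam / n)) 1).map
    fun z => ∑ i, z i ^ 2

/-- The noncentral F distribution with `n₁` and `n₂` degrees of freedom and noncentrality
parameter `lam`: the law of `(X / n₁) / (Y / n₂)` for independent `X`, `Y`, where `X` is
noncentral chi-square with `n₁` degrees of freedom and parameter `lam` and `Y` is (central)
chi-square with `n₂` degrees of freedom. -/
def noncentralF (n₁ n₂ : ℕ) (lam : ℝ) : Measure ℝ :=
  ((noncentralChiSq n₁ lam).prod (noncentralChiSq n₂ 0)).map
    fun q => (q.1 / n₁) / (q.2 / n₂)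

/-- The cumulative distribution function `F(x | n₁, n₂, lam)` of the noncentral F distribution. -/
def noncentralFCDF (x : ℝ) (n₁ n₂ : ℕ) (lam : ℝ) : ℝ :=
  (noncentralF n₁ n₂ lam).real (Set.Iic x)

/-! ### Beamforming gains and miss-detection probabilities -/

/-- The average gain `G(φ) = (1 / J) ∑ j, G_j(φ)` of `J` beamformers in direction `φ`. -/
def avgGain {Φ : Type*} {J : ℕ} (Gj : Fin J → Φ → ℝ) (φ : Φ) : ℝ :=
  (1 / (J : ℝ)) * ∑ j, Gj j φ

/-- The normalised noncentrality parameter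
`η(φ) = 2 P_T N_R N_s / (α(φ) σ²) * G(φ)` of a UE in direction `φ`. -/
def eta {Φ : Type*} {J : ℕ} (N_R N_s : ℕ) (P_T σ : ℝ) (α : Φ → ℝ) (Gj : Fin J → Φ → ℝ)
    (φ : Φ) : ℝ :=
  2 * P_T * N_R * N_s / (α φ * σ ^ 2) * avgGain Gj φ

/-- The miss-detection probability `Pr {L_G ≤ γ}` after `L` slots, where the test statistic `L_G`
is such that `(N_s - 1) L_G` has the noncentral F distribution with `2 N_R L` and
`2 N_R L (N_s - 1)` degrees of freedom and noncentrality parameter `L η`. -/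
def missProb (N_R N_s : ℕ) (γ : ℝ) (L : ℕ) (η : ℝ) : ℝ :=
  noncentralFCDF (((N_s : ℝ) - 1) * γ) (2 * N_R * L) (2 * N_R * L * (N_s - 1)) (L * η)

/-- The average miss-detection probability `∫_Ω p_miss(φ) p(φ) dφ` over the directions in `Ω`,
where `p` is the density of the UE direction with respect to `μ`. -/
def avgMissProb {Φ : Type*} [MeasurableSpace Φ] (μ : Measure Φ) (Ω : Set Φ) (p : Φ → ℝ)
    (N_R N_s : ℕ) (γ : ℝ) (η : Φ → ℝ) (L : ℕ) : ℝ :=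
  ∫ φ in Ω, missProb N_R N_s γ L (η φ) * p φ ∂μ

/-! ### The rate function -/

/-- The unique positive solution `x*` of
`(γ + 1) / (η γ) * (x² - N_R²) - x - N_R - 2 N_R (N_s - 1) = 0`, in closed form
(see `rateX_pos`, `rateX_root`, `rateX_unique`); the closed form also makes sense for `η = 0`. -/
def rateX (N_R N_s : ℕ) (η γ : ℝ) : ℝ :=
  (η * γ + Real.sqrt ((η * γ) ^ 2 + 4 * (γ + 1) *
      ((γ + 1) * (N_R : ℝ) ^ 2 + η * γ * (N_R + 2 * N_R * ((N_s : ℝ) - 1))))) / (2 * (γ + 1))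

/-- The point `v* = (x*² - N_R²) / (η γ)` (see `rateV_eq`), written through the equation for `x*`
in a form that does not divide by `η`, so that it also makes sense for `η = 0`. -/
def rateV (N_R N_s : ℕ) (η γ : ℝ) : ℝ :=
  (rateX N_R N_s η γ + N_R + 2 * N_R * ((N_s : ℝ) - 1)) / (γ + 1)

/-- The rate function `I*(η, γ)`. -/
def rateFunction (N_R N_s : ℕ) (η γ : ℝ) : ℝ :=
  η / 2 * (1 - γ * rateV N_R N_s η γ /
      (N_R + Real.sqrt ((N_R : ℝ) ^ 2 + γ * η * rateV N_R N_s η γ)))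
    + N_R * ((N_s : ℝ) - 1) * Real.log (2 * N_R * ((N_s : ℝ) - 1) / rateV N_R N_s η γ)
    - N_R * Real.log (γ * rateV N_R N_s η γ /
      (N_R + Real.sqrt ((N_R : ℝ) ^ 2 + γ * η * rateV N_R N_s η γ)))

theorem rateX_quadratic {N_R N_s : ℕ} {η γ : ℝ} (hs : 1 ≤ N_s) (hη : 0 ≤ η) (hγ : 0 < γ) :
    (γ + 1) * (rateX N_R N_s η γ ^ 2 - (N_R : ℝ) ^ 2)
      = η * γ * (rateX N_R N_s η γ + N_R + 2 * N_R * ((N_s : ℝ) - 1)) := by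
  have h1 : (0 : ℝ) ≤ (N_s : ℝ) - 1 := by
    have : (1 : ℝ) ≤ N_s := by exact_mod_cast hs
    linarith
  have hD : 0 ≤ (η * γ) ^ 2 + 4 * (γ + 1) *
      ((γ + 1) * (N_R : ℝ) ^ 2 + η * γ * (N_R + 2 * N_R * ((N_s : ℝ) - 1))) := by positivity
  have hsq := Real.sq_sqrt hD
  unfold rateX
  set r := Real.sqrt ((η * γ) ^ 2 + 4 * (γ + 1) *
      ((γ + 1) * (N_R : ℝ) ^ 2 + η * γ * (N_R + 2 * N_R * ((N_s : ℝ) - 1))))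
  have h2 : γ + 1 ≠ 0 := by positivity
  field_simp
  linear_combination hsq

theorem rateX_pos {N_R N_s : ℕ} {η γ : ℝ} (hR : 1 ≤ N_R) (hs : 1 ≤ N_s) (hη : 0 ≤ η)
    (hγ : 0 < γ) : 0 < rateX N_R N_s η γ := by
  have h1 : (0 : ℝ) ≤ (N_s : ℝ) - 1 := by
    have : (1 : ℝ) ≤ N_s := by exact_mod_cast hs
    linarith
  have h2 : (0 : ℝ) < N_R := by exact_mod_cast hR
  unfold rateX
  positivity

/-- `x*` solves the defining equation. -/
theorem rateX_root {N_R N_s : ℕ} {η γ : ℝ} (hs : 1 ≤ N_s) (hη : 0 < η) (hγ : 0 < γ) :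
    (γ + 1) / (η * γ) * (rateX N_R N_s η γ ^ 2 - (N_R : ℝ) ^ 2)
      - rateX N_R N_s η γ - N_R - 2 * N_R * ((N_s : ℝ) - 1) = 0 := by
  have h := rateX_quadratic (N_R := N_R) hs hη.le hγ
  field_simp
  linear_combination h

/-- `x*` is the only positive solution of the defining equation. -/
theorem rateX_unique {N_R N_s : ℕ} {η γ : ℝ} (hR : 1 ≤ N_R) (hs : 1 ≤ N_s) (hη : 0 < η)
    (hγ : 0 < γ) {x : ℝ} (hx : 0 < x)
    (h : (γ + 1) / (η * γ) * (x ^ 2 - (N_R : ℝ) ^ 2)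
      - x - N_R - 2 * N_R * ((N_s : ℝ) - 1) = 0) : x = rateX N_R N_s η γ := by
  have h0 := rateX_root (N_R := N_R) hs hη hγ
  have hy := rateX_pos hR hs hη.le hγ
  set y := rateX N_R N_s η γ
  have h1 : (0 : ℝ) ≤ (N_s : ℝ) - 1 := by
    have : (1 : ℝ) ≤ N_s := by exact_mod_cast hs
    linarith
  have h2 : (0 : ℝ) < N_R := by exact_mod_cast hR
  have hc : 0 < (γ + 1) / (η * γ) := by positivity
  set c := (γ + 1) / (η * γ)
  have key : (x - y) * (c * (x * y) + c * (N_R : ℝ) ^ 2 + N_R + 2 * N_R * ((N_s : ℝ) - 1)) = 0 := by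
    linear_combination y * h - x * h0
  have hpos : 0 < c * (x * y) + c * (N_R : ℝ) ^ 2 + N_R + 2 * N_R * ((N_s : ℝ) - 1) := by
    positivity
  rcases mul_eq_zero.mp key with h3 | h3
  · linarith
  · exact absurd h3 hpos.ne'

theorem rateV_eq {N_R N_s : ℕ} {η γ : ℝ} (hs : 1 ≤ N_s) (hη : 0 < η) (hγ : 0 < γ) :
    rateV N_R N_s η γ = (rateX N_R N_s η γ ^ 2 - (N_R : ℝ) ^ 2) / (η * γ) := by
  have h := rateX_quadratic (N_R := N_R) hs hη.le hγ
  unfold rateV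
  field_simp
  linear_combination -h

end BSDiscovery

end

/-!
The noncentrality of `X` after `L` slots is `L η` over `2 N_R L` degrees of freedom, so each of its
normal coordinates has a mean that does not depend on `L`, and a miss-detection is the event
`S ≤ 0` for `S = X - γ Y`, a sum of `L` independent copies of one random variable. Only one
consequence of this is used: the Laplace transform of `S` at `t` is `exp (-L g_η(t))`, with
`g_η(t) = N_R log (1 + 2t) + η t / (1 + 2t) + N_R (N_s - 1) log (1 - 2γt)`
(`integral_exp_slotLaw`). This `g_η` is strictly concave, so its maximum over `t ≥ 0` is
characterised by first-order conditions.

* Upper bound: Chernoff (`missProb_le`).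
* Lower bound: if `t` lies slightly to the right of the maximiser `t₀`, then in
  `E exp (-t S)` the part over `S > 0` is dominated by the transform at `t₀` and the part over
  `S < -L β` by the transform at a point beyond `t`. Both are exponentially smaller than the whole,
  so the part over `-L β ≤ S ≤ 0` carries it. Letting `t → t₀` gives the rate `g_η(t₀)`
  (`eventually_exp_le_missProb`), since `t₀ g_η'(t₀) = 0`.

For the average over directions, let `η₀` be the essential infimum of `η(φ)` under the law of the
direction. As `g_η` increases with `η`, the Chernoff bound holds uniformly with `η₀` in place of
`η`; as `g_η` is moreover Lipschitz in `η`, a set of positive probability decays at a rate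
arbitrarily close to the maximum of `g_{η₀}`. Hence the limit exists and is that maximum
(`exists_tendsto_log_integral_missProb`). Finally `η₀ ≤ η⁻`, and `I*(η⁻, γ)` is the value of
`g_{η⁻}` at its stationary point, thus its global maximum (`chernoffExponent_le_rateFunction`).
-/

namespace BSDiscovery

open MeasureTheory ProbabilityTheory Filter Topology

/-! ### Laplace transforms of the chi-square laws -/

theorem gaussianPDFReal_mul_exp_sq {θ : ℝ} (hθ : θ < 1 / 2) (m x : ℝ) :
    gaussianPDFReal m 1 x * Real.exp (θ * x ^ 2)
      = Real.exp (-(1 / 2) * Real.log (1 - 2 * θ) + m ^ 2 * (θ / (1 - 2 * θ))) *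
        gaussianPDFReal (m / (1 - 2 * θ)) (Real.toNNReal (1 / (1 - 2 * θ))) x := by
  have hd : 0 < 1 - 2 * θ := by linarith
  have hθd : θ = (1 - (1 - 2 * θ)) / 2 := by ring
  set d := 1 - 2 * θ
  have hsqrt : Real.exp (-(1 / 2) * Real.log d) = (√d)⁻¹ := by
    rw [Real.sqrt_eq_rpow, ← Real.rpow_neg hd.le, Real.rpow_def_of_pos hd]
    ring_nf
  have hs : √(2 * Real.pi * (1 / d)) = √(2 * Real.pi) * (√d)⁻¹ := by
    rw [Real.sqrt_mul (by positivity), one_div, Real.sqrt_inv]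
  have hsd : √d ≠ 0 := (Real.sqrt_pos.mpr hd).ne'
  rw [gaussianPDFReal, gaussianPDFReal, Real.coe_toNNReal _ (by positivity), hs, Real.exp_add,
    hsqrt, mul_assoc, ← Real.exp_add]
  have hexp : -(x - m) ^ 2 / (2 * ((1 : NNReal) : ℝ)) + θ * x ^ 2
      = m ^ 2 * (θ / d) + -(x - m / d) ^ 2 / (2 * (1 / d)) := by
    rw [hθd, NNReal.coe_one]
    field_simp
    ring
  rw [hexp, Real.exp_add, NNReal.coe_one]
  field_simp

theorem integrable_exp_sq_gaussianReal {θ : ℝ} (hθ : θ < 1 / 2) (m : ℝ) :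
    Integrable (fun x => Real.exp (θ * x ^ 2)) (gaussianReal m 1) := by
  rw [gaussianReal_of_var_ne_zero _ one_ne_zero,
    integrable_withDensity_iff_integrable_smul' (measurable_gaussianPDF _ _)
      (ae_of_all _ fun _ => gaussianPDF_lt_top)]
  simp only [toReal_gaussianPDF, smul_eq_mul, gaussianPDFReal_mul_exp_sq hθ]
  exact (integrable_gaussianPDFReal _ _).const_mul _

/-- Multiplying the `N(m, 1)` density by `exp (θ x²)` gives, up to a constant, another normal
density; the constant is the integral. -/
theorem integral_exp_sq_gaussianReal {θ : ℝ} (hθ : θ < 1 / 2) (m : ℝ) :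
    ∫ x, Real.exp (θ * x ^ 2) ∂(gaussianReal m 1)
      = Real.exp (-(1 / 2) * Real.log (1 - 2 * θ) + m ^ 2 * (θ / (1 - 2 * θ))) := by
  have hd : 0 < 1 / (1 - 2 * θ) := by
    have : 0 < 1 - 2 * θ := by linarith
    positivity
  rw [integral_gaussianReal_eq_integral_smul one_ne_zero]
  simp only [smul_eq_mul, gaussianPDFReal_mul_exp_sq hθ]
  rw [integral_const_mul, integral_gaussianPDFReal_eq_one _ (Real.toNNReal_pos.mpr hd).ne', mul_one]

theorem measurable_sum_sq (n : ℕ) : Measurable fun z : Fin n → ℝ => ∑ i, z i ^ 2 := by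
  fun_prop

instance (n : ℕ) (lam : ℝ) : IsProbabilityMeasure (noncentralChiSq n lam) :=
  Measure.isProbabilityMeasure_map (measurable_sum_sq n).aemeasurable

theorem integrable_exp_noncentralChiSq {θ : ℝ} (hθ : θ < 1 / 2) (n : ℕ) (lam : ℝ) :
    Integrable (fun x => Real.exp (θ * x)) (noncentralChiSq n lam) := by
  rw [noncentralChiSq, integrable_map_measure (by fun_prop) (measurable_sum_sq n).aemeasurable]
  simp only [Function.comp_def, Finset.mul_sum, Real.exp_sum]
  exact Integrable.fintype_prod fun _ => integrable_exp_sq_gaussianReal hθ _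

theorem integral_exp_noncentralChiSq {θ : ℝ} (hθ : θ < 1 / 2) {n : ℕ} (hn : n ≠ 0) {lam : ℝ}
    (hlam : 0 ≤ lam) :
    ∫ x, Real.exp (θ * x) ∂(noncentralChiSq n lam)
      = Real.exp (-(n / 2) * Real.log (1 - 2 * θ) + lam * (θ / (1 - 2 * θ))) := by
  have hn' : (n : ℝ) ≠ 0 := by exact_mod_cast hn
  rw [noncentralChiSq, integral_map (measurable_sum_sq n).aemeasurable (by fun_prop)]
  simp only [Finset.mul_sum, Real.exp_sum]
  rw [integral_fintype_prod_eq_pow (fun x : ℝ => Real.exp (θ * x ^ 2)),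
    integral_exp_sq_gaussianReal hθ, ← Real.exp_nat_mul, Fintype.card_fin,
    Real.sq_sqrt (by positivity)]
  congr 1
  field_simp

theorem ae_pos_noncentralChiSq {n : ℕ} (hn : n ≠ 0) (lam : ℝ) :
    ∀ᵐ y ∂(noncentralChiSq n lam), 0 < y := by
  have : Nonempty (Fin n) := ⟨⟨0, Nat.pos_of_ne_zero hn⟩⟩
  have : NullSingletonClass (gaussianReal (Real.sqrt (lam / n)) 1) :=
    nullSingletonClass_gaussianReal one_ne_zero
  rw [noncentralChiSq, ae_map_iff (measurable_sum_sq n).aemeasurable measurableSet_Ioi]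
  filter_upwards [Measure.ae_eval_ne (fun _ : Fin n => gaussianReal (Real.sqrt (lam / n)) 1)
    (Classical.arbitrary (Fin n)) 0] with z hz
  exact Finset.sum_pos' (fun i _ => sq_nonneg _)
    ⟨_, Finset.mem_univ _, lt_of_le_of_ne (sq_nonneg _) (pow_ne_zero 2 hz).symm⟩

/-! ### The miss-detection event as a left tail -/

/-- The joint law of the numerator `X` and the denominator `Y` of the test statistic after `L`
slots. -/
noncomputable def slotLaw (N_R N_s L : ℕ) (η : ℝ) : Measure (ℝ × ℝ) :=
  (noncentralChiSq (2 * N_R * L) (L * η)).prod (noncentralChiSq (2 * N_R * L * (N_s - 1)) 0)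

instance (N_R N_s L : ℕ) (η : ℝ) : IsProbabilityMeasure (slotLaw N_R N_s L η) := by
  unfold slotLaw; infer_instance

/-- Since `Y > 0` almost surely, a miss-detection is the event `X - γ Y ≤ 0`. -/
theorem missProb_eq {N_R N_s L : ℕ} (hR : 1 ≤ N_R) (hs : 2 ≤ N_s) (hL : 1 ≤ L) (γ η : ℝ) :
    missProb N_R N_s γ L η = (slotLaw N_R N_s L η).real {q | q.1 - γ * q.2 ≤ 0} := by
  obtain ⟨k, rfl⟩ : ∃ k, N_s = k + 1 := ⟨N_s - 1, by omega⟩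
  have hk : 1 ≤ k := by omega
  have hpos : ∀ᵐ q ∂(slotLaw N_R (k + 1) L η), 0 < q.2 :=
    Measure.quasiMeasurePreserving_snd.ae (ae_pos_noncentralChiSq (by
      simp only [Nat.add_sub_cancel]; positivity) 0)
  have hk' : (0 : ℝ) < k := by exact_mod_cast hk
  have hL' : (0 : ℝ) < L := by exact_mod_cast hL
  have hR' : (0 : ℝ) < N_R := by exact_mod_cast hR
  rw [missProb, noncentralFCDF, noncentralF, map_measureReal_apply (by fun_prop) measurableSet_Iic]
  refine measureReal_congr ?_
  filter_upwards [hpos] with q hq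
  refine propext ?_
  change (q.1 / ((2 * N_R * L : ℕ) : ℝ)) / (q.2 / ((2 * N_R * L * (k + 1 - 1) : ℕ) : ℝ))
    ≤ ((k + 1 : ℕ) - 1 : ℝ) * γ ↔ q.1 - γ * q.2 ≤ 0
  have h : (q.1 / ((2 * N_R * L : ℕ) : ℝ)) / (q.2 / ((2 * N_R * L * (k + 1 - 1) : ℕ) : ℝ))
      = k * (q.1 / q.2) := by
    simp only [Nat.add_sub_cancel]
    push_cast
    field_simp
  rw [h]
  push_cast
  rw [add_sub_cancel_right, mul_le_mul_iff_right₀ hk', div_le_iff₀ hq, sub_nonpos]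

/-- The noncentral chi-square law as the image of a standard normal vector. -/
theorem noncentralChiSq_eq_map_std (n : ℕ) (lam : ℝ) :
    noncentralChiSq n lam = (Measure.pi fun _ : Fin n => gaussianReal 0 1).map
      fun z => ∑ i, (z i + Real.sqrt (lam / n)) ^ 2 := by
  have h := Measure.pi_map_pi (μ := fun _ : Fin n => gaussianReal 0 1)
    (f := fun _ x => x + Real.sqrt (lam / n))
    (hμ := fun _ => by rw [gaussianReal_map_add_const]; infer_instance) (fun _ => by fun_prop)
  simp only [gaussianReal_map_add_const, zero_add] at h
  rw [noncentralChiSq, ← h, Measure.map_map (measurable_sum_sq n) (by fun_prop)]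
  rfl

theorem measurable_missProb (N_R N_s : ℕ) (γ : ℝ) (L : ℕ) :
    Measurable (missProb N_R N_s γ L) := by
  set n₁ := 2 * N_R * L
  set n₂ := 2 * N_R * L * (N_s - 1)
  set ρ : Measure ((Fin n₁ → ℝ) × ℝ) :=
    (Measure.pi fun _ : Fin n₁ => gaussianReal 0 1).prod (noncentralChiSq n₂ 0)
  set F : ℝ × ((Fin n₁ → ℝ) × ℝ) → ℝ :=
    fun w => ((∑ i, (w.2.1 i + Real.sqrt (L * w.1 / n₁)) ^ 2) / n₁) / (w.2.2 / n₂)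
  have hF : Measurable F := by fun_prop
  have key : missProb N_R N_s γ L
      = fun η => (ρ (Prod.mk η ⁻¹' (F ⁻¹' Set.Iic (((N_s : ℝ) - 1) * γ)))).toReal := by
    funext η
    have hm : noncentralF n₁ n₂ (L * η) = ρ.map fun z => F (η, z) := by
      have h := Measure.map_prod_map (Measure.pi fun _ : Fin n₁ => gaussianReal 0 1)
        (noncentralChiSq n₂ 0) (f := fun z => ∑ i, (z i + Real.sqrt (L * η / n₁)) ^ 2) (g := id)
        (by fun_prop) measurable_id
      rw [Measure.map_id] at h
      rw [noncentralF, noncentralChiSq_eq_map_std n₁, h, Measure.map_map (by fun_prop)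
        (by fun_prop)]
      rfl
    rw [missProb, noncentralFCDF, hm, map_measureReal_apply (by fun_prop) measurableSet_Iic]
    rfl
  rw [key]
  exact (measurable_measure_prodMk_left (hF measurableSet_Iic)).ennreal_toReal

theorem missProb_nonneg (N_R N_s : ℕ) (γ : ℝ) (L : ℕ) (η : ℝ) : 0 ≤ missProb N_R N_s γ L η :=
  measureReal_nonneg

/-! ### The Chernoff exponent -/

/-- The Chernoff exponent at `t` of the left tail of `X - γ Y`: minus the logarithm, per slot, of
`E exp (-t (X - γ Y))`. The number of degrees of freedom per slot is `2 a` for `X`, `2 b` for `Y`,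
and `η` is the noncentrality per slot. -/
noncomputable def chernoffExponent (a b γ η t : ℝ) : ℝ :=
  a * Real.log (1 + 2 * t) + η * (t / (1 + 2 * t)) + b * Real.log (1 - 2 * γ * t)

/-- The derivative of `chernoffExponent a b γ η`. -/
noncomputable def chernoffSlope (a b γ η t : ℝ) : ℝ :=
  2 * a / (1 + 2 * t) + η / (1 + 2 * t) ^ 2 - 2 * γ * b / (1 - 2 * γ * t)

theorem hasDerivAt_chernoffExponent {a b γ η t : ℝ} (h1 : 0 < 1 + 2 * t)
    (h2 : 0 < 1 - 2 * γ * t) :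
    HasDerivAt (chernoffExponent a b γ η) (chernoffSlope a b γ η t) t := by
  have d1 : HasDerivAt (fun t : ℝ => 1 + 2 * t) 2 t := by
    simpa using ((hasDerivAt_id t).const_mul 2).const_add 1
  have d2 : HasDerivAt (fun t : ℝ => 1 - 2 * γ * t) (-(2 * γ)) t := by
    simpa using ((hasDerivAt_id t).const_mul (2 * γ)).const_sub 1
  refine ((((d1.log h1.ne').const_mul a).add
    (((hasDerivAt_id t).div d1 h1.ne').const_mul η)).add
      ((d2.log h2.ne').const_mul b)).congr_deriv ?_
  rw [chernoffSlope]
  simp only [id]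
  field_simp
  ring

/-- The Chernoff exponent is strictly concave: it lies strictly below its tangents. -/
theorem chernoffExponent_lt_tangent {a b γ η s t : ℝ} (ha : 0 < a) (hb : 0 ≤ b) (hη : 0 ≤ η)
    (hs1 : 0 < 1 + 2 * s) (hs2 : 0 < 1 - 2 * γ * s) (ht1 : 0 < 1 + 2 * t)
    (ht2 : 0 < 1 - 2 * γ * t) (hst : t ≠ s) :
    chernoffExponent a b γ η t
      < chernoffExponent a b γ η s + (t - s) * chernoffSlope a b γ η s := by
  have l1 : Real.log (1 + 2 * t) - Real.log (1 + 2 * s) < (t - s) * (2 / (1 + 2 * s)) := by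
    rw [← Real.log_div ht1.ne' hs1.ne']
    have hne : (1 + 2 * t) / (1 + 2 * s) ≠ 1 := by
      rw [Ne, div_eq_one_iff_eq hs1.ne']
      exact fun h => hst (by linarith)
    refine (Real.log_lt_sub_one_of_pos (by positivity) hne).trans_eq ?_
    field_simp
    ring
  have l2 : t / (1 + 2 * t) - s / (1 + 2 * s) ≤ (t - s) * (1 / (1 + 2 * s) ^ 2) := by
    have : (t - s) * (1 / (1 + 2 * s) ^ 2) - (t / (1 + 2 * t) - s / (1 + 2 * s))
        = 2 * (t - s) ^ 2 / ((1 + 2 * s) ^ 2 * (1 + 2 * t)) := by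
      rw [div_sub_div _ _ ht1.ne' hs1.ne', mul_one_div, div_sub_div _ _ (by positivity)
        (by positivity), div_eq_div_iff (by positivity) (by positivity)]
      ring
    have h0 : 0 ≤ 2 * (t - s) ^ 2 / ((1 + 2 * s) ^ 2 * (1 + 2 * t)) := by positivity
    linarith
  have l3 : Real.log (1 - 2 * γ * t) - Real.log (1 - 2 * γ * s)
      ≤ (t - s) * (-(2 * γ) / (1 - 2 * γ * s)) := by
    rw [← Real.log_div ht2.ne' hs2.ne']
    refine (Real.log_le_sub_one_of_pos (by positivity)).trans_eq ?_
    field_simp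
    ring
  have m1 := mul_lt_mul_of_pos_left l1 ha
  have m2 := mul_le_mul_of_nonneg_left l2 hη
  have m3 := mul_le_mul_of_nonneg_left l3 hb
  have e : (t - s) * chernoffSlope a b γ η s = a * ((t - s) * (2 / (1 + 2 * s)))
      + η * ((t - s) * (1 / (1 + 2 * s) ^ 2)) + b * ((t - s) * (-(2 * γ) / (1 - 2 * γ * s))) := by
    rw [chernoffSlope]
    ring
  rw [e, chernoffExponent, chernoffExponent]
  linarith

theorem chernoffExponent_mono {a b γ t η η' : ℝ} (ht : 0 ≤ t) (h : η ≤ η') :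
    chernoffExponent a b γ η t ≤ chernoffExponent a b γ η' t := by
  have : 0 ≤ t / (1 + 2 * t) := by positivity
  rw [chernoffExponent, chernoffExponent]
  gcongr

theorem chernoffExponent_le_add {a b γ t η η' : ℝ} (ht : 0 ≤ t) (h : η ≤ η') :
    chernoffExponent a b γ η' t ≤ chernoffExponent a b γ η t + (η' - η) / 2 := by
  have h1 : t / (1 + 2 * t) ≤ 1 / 2 := by
    rw [div_le_div_iff₀ (by positivity) (by norm_num)]
    linarith
  have := mul_le_mul_of_nonneg_left h1 (sub_nonneg.mpr h)
  rw [chernoffExponent, chernoffExponent]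
  linarith

theorem chernoffSlope_antitone {a b γ η s t : ℝ} (ha : 0 ≤ a) (hb : 0 ≤ b) (hγ : 0 < γ)
    (hη : 0 ≤ η) (hs : 0 < 1 + 2 * s) (ht : 0 < 1 - 2 * γ * t) (hst : s ≤ t) :
    chernoffSlope a b γ η t ≤ chernoffSlope a b γ η s := by
  rw [chernoffSlope, chernoffSlope]
  gcongr

/-! ### Exponential bounds for the miss-detection probability -/

theorem integrable_exp_slotLaw {γ t : ℝ} (h1 : 0 < 1 + 2 * t) (h2 : 0 < 1 - 2 * γ * t)
    (N_R N_s L : ℕ) (η : ℝ) :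
    Integrable (fun q : ℝ × ℝ => Real.exp (-t * (q.1 - γ * q.2))) (slotLaw N_R N_s L η) := by
  have e : (fun q : ℝ × ℝ => Real.exp (-t * (q.1 - γ * q.2)))
      = fun q => Real.exp (-t * q.1) * Real.exp (t * γ * q.2) := by
    funext q
    rw [← Real.exp_add]
    ring_nf
  rw [e]
  exact (integrable_exp_noncentralChiSq (by linarith) _ _).mul_prod
    (integrable_exp_noncentralChiSq (by linarith) _ _)

theorem integral_exp_slotLaw {γ t : ℝ} (h1 : 0 < 1 + 2 * t) (h2 : 0 < 1 - 2 * γ * t)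
    {N_R N_s L : ℕ} (hR : 1 ≤ N_R) (hs : 2 ≤ N_s) (hL : 1 ≤ L) {η : ℝ} (hη : 0 ≤ η) :
    ∫ q, Real.exp (-t * (q.1 - γ * q.2)) ∂(slotLaw N_R N_s L η)
      = Real.exp (-L * chernoffExponent N_R (N_R * ((N_s : ℝ) - 1)) γ η t) := by
  obtain ⟨k, rfl⟩ : ∃ k, N_s = k + 1 := ⟨N_s - 1, by omega⟩
  have hk : 1 ≤ k := by omega
  have e : (fun q : ℝ × ℝ => Real.exp (-t * (q.1 - γ * q.2)))
      = fun q => Real.exp (-t * q.1) * Real.exp (t * γ * q.2) := by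
    funext q
    rw [← Real.exp_add]
    ring_nf
  rw [e, slotLaw, integral_prod_mul (fun x => Real.exp (-t * x)) (fun y => Real.exp (t * γ * y)),
    integral_exp_noncentralChiSq (by linarith) (by positivity) (by positivity),
    integral_exp_noncentralChiSq (by linarith) (by simp only [Nat.add_sub_cancel]; positivity)
      le_rfl, ← Real.exp_add, chernoffExponent, show 1 - 2 * -t = 1 + 2 * t by ring,
    show 1 - 2 * (t * γ) = 1 - 2 * γ * t by ring]
  congr 1
  simp only [Nat.add_sub_cancel]
  push_cast
  ring

/-- The Chernoff bound. -/
theorem missProb_le {γ t : ℝ} (ht : 0 ≤ t) (h2 : 0 < 1 - 2 * γ * t)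
    {N_R N_s L : ℕ} (hR : 1 ≤ N_R) (hs : 2 ≤ N_s) (hL : 1 ≤ L) {η : ℝ} (hη : 0 ≤ η) :
    missProb N_R N_s γ L η
      ≤ Real.exp (-L * chernoffExponent N_R (N_R * ((N_s : ℝ) - 1)) γ η t) := by
  rw [missProb_eq hR hs hL, ← integral_exp_slotLaw (by positivity) h2 hR hs hL hη]
  have h := mul_meas_ge_le_integral_of_nonneg
    (ae_of_all _ fun q : ℝ × ℝ => (Real.exp_pos (-t * (q.1 - γ * q.2))).le)
    (integrable_exp_slotLaw (by positivity) h2 N_R N_s L η) 1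
  rw [one_mul] at h
  refine le_trans (measureReal_mono fun q hq => ?_) h
  exact Real.one_le_exp (mul_nonneg_of_nonpos_of_nonpos (by linarith) hq)

/-- A lower bound for a left tail by Laplace transforms at `t₀ ≤ t ≤ t₁`: the parts of
`E exp (-t S)` over `S > 0` and over `S < -β` are dominated by the transforms at `t₀` and `t₁`, and
the rest is at most `exp (t β) P (S ≤ 0)`. -/
theorem laplace_sub_le_exp_mul_measureReal {Ω : Type*} [MeasurableSpace Ω] {P : Measure Ω}
    [IsFiniteMeasure P] {S : Ω → ℝ} (hS : Measurable S) {t₀ t t₁ β : ℝ} (ht : 0 ≤ t) (h0 : t₀ ≤ t)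
    (h1 : t ≤ t₁) (i0 : Integrable (fun ω => Real.exp (-t₀ * S ω)) P)
    (i : Integrable (fun ω => Real.exp (-t * S ω)) P)
    (i1 : Integrable (fun ω => Real.exp (-t₁ * S ω)) P) :
    ∫ ω, Real.exp (-t * S ω) ∂P - ∫ ω, Real.exp (-t₀ * S ω) ∂P
        - Real.exp (-(t₁ - t) * β) * ∫ ω, Real.exp (-t₁ * S ω) ∂P
      ≤ Real.exp (t * β) * P.real {ω | S ω ≤ 0} := by
  have hm : MeasurableSet {ω | S ω ≤ 0} := hS measurableSet_Iic
  have hi : Integrable ({ω | S ω ≤ 0}.indicator fun _ => (1 : ℝ)) P :=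
    (integrable_const 1).indicator hm
  have key : ∀ ω, Real.exp (-t * S ω) ≤ Real.exp (-t₀ * S ω)
      + Real.exp (-(t₁ - t) * β) * Real.exp (-t₁ * S ω)
      + Real.exp (t * β) * {ω | S ω ≤ 0}.indicator (fun _ => (1 : ℝ)) ω := by
    intro ω
    have p0 := Real.exp_pos (-t₀ * S ω)
    have p1 : 0 < Real.exp (-(t₁ - t) * β) * Real.exp (-t₁ * S ω) := by positivity
    have p2 : 0 ≤ Real.exp (t * β) * {ω | S ω ≤ 0}.indicator (fun _ => (1 : ℝ)) ω :=
      mul_nonneg (Real.exp_pos _).le (Set.indicator_nonneg (fun _ _ => zero_le_one) _)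
    by_cases hpos : 0 < S ω
    · have : Real.exp (-t * S ω) ≤ Real.exp (-t₀ * S ω) := by
        apply Real.exp_le_exp.mpr
        nlinarith
      linarith
    · by_cases hlow : S ω < -β
      · have : Real.exp (-t * S ω) ≤ Real.exp (-(t₁ - t) * β) * Real.exp (-t₁ * S ω) := by
          rw [← Real.exp_add]
          apply Real.exp_le_exp.mpr
          nlinarith
        linarith
      · have hmem : ω ∈ {ω | S ω ≤ 0} := not_lt.mp hpos
        rw [Set.indicator_of_mem hmem, mul_one]
        have : Real.exp (-t * S ω) ≤ Real.exp (t * β) := by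
          apply Real.exp_le_exp.mpr
          nlinarith
        linarith
  have h := integral_mono i ((i0.add (i1.const_mul _)).add (hi.const_mul _)) key
  rw [integral_add' (i0.add (i1.const_mul _)) (hi.const_mul _), integral_add' i0 (i1.const_mul _),
    integral_const_mul, integral_const_mul, integral_indicator_const _ hm, smul_eq_mul, mul_one] at h
  linarith

/-- With `L β` for the window, the two subtracted terms of `laplace_sub_le_exp_mul_measureReal` at
`t₀ ≤ t ≤ t + δ` are exponentially smaller than the first under `hleft` and `hright`. Then the
miss-detection probability decays no faster than at rate `t β` plus the exponent at `t`. -/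
theorem eventually_exp_le_missProb_of_lt {γ t₀ t δ β c : ℝ} (ht₀ : 0 ≤ t₀) (h0 : t₀ ≤ t)
    (hδ : 0 ≤ δ) (hγ : 0 < γ) (h2 : 0 < 1 - 2 * γ * (t + δ))
    {N_R N_s : ℕ} (hR : 1 ≤ N_R) (hs : 2 ≤ N_s) {η : ℝ} (hη : 0 ≤ η)
    (hleft : chernoffExponent N_R (N_R * ((N_s : ℝ) - 1)) γ η t
      < chernoffExponent N_R (N_R * ((N_s : ℝ) - 1)) γ η t₀)
    (hright : chernoffExponent N_R (N_R * ((N_s : ℝ) - 1)) γ η t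
      < chernoffExponent N_R (N_R * ((N_s : ℝ) - 1)) γ η (t + δ) + δ * β)
    (hc : chernoffExponent N_R (N_R * ((N_s : ℝ) - 1)) γ η t + t * β < c) :
    ∀ᶠ L : ℕ in atTop, Real.exp (-L * c) ≤ missProb N_R N_s γ L η := by
  set g := chernoffExponent N_R (N_R * ((N_s : ℝ) - 1)) γ η
  have hdecay : ∀ {r : ℝ}, 0 < r → ∀ᶠ L : ℕ in atTop, Real.exp (-L * r) < 1 / 3 := by
    intro r hr
    have : Tendsto (fun L : ℕ => Real.exp (-L * r)) atTop (𝓝 0) := by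
      refine Real.tendsto_exp_atBot.comp ?_
      have := (tendsto_natCast_atTop_atTop (R := ℝ)).atTop_mul_const hr
      simpa only [neg_mul, Function.comp_def] using tendsto_neg_atTop_atBot.comp this
    exact this.eventually (gt_mem_nhds (by norm_num))
  filter_upwards [eventually_ge_atTop 1, hdecay (sub_pos.mpr hleft), hdecay (sub_pos.mpr hright),
    hdecay (sub_pos.mpr hc)] with L hL e1 e2 e3
  have hγδ : 0 ≤ γ * δ := by positivity
  have hγt : 0 ≤ γ * (t - t₀) := mul_nonneg hγ.le (sub_nonneg.mpr h0)
  have ht : 0 ≤ t := ht₀.trans h0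
  have a0 : 0 < 1 + 2 * t₀ := by positivity
  have a1 : 0 < 1 + 2 * t := by positivity
  have a2 : 0 < 1 + 2 * (t + δ) := by positivity
  have b0 : 0 < 1 - 2 * γ * t₀ := by nlinarith
  have b1 : 0 < 1 - 2 * γ * t := by nlinarith
  have h := laplace_sub_le_exp_mul_measureReal (P := slotLaw N_R N_s L η)
    (S := fun q => q.1 - γ * q.2) (β := L * β) (by fun_prop) ht h0 (t₁ := t + δ) (by linarith)
    (integrable_exp_slotLaw a0 b0 _ _ _ _) (integrable_exp_slotLaw a1 b1 _ _ _ _)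
    (integrable_exp_slotLaw a2 h2 _ _ _ _)
  rw [integral_exp_slotLaw a0 b0 hR hs hL hη, integral_exp_slotLaw a1 b1 hR hs hL hη,
    integral_exp_slotLaw a2 h2 hR hs hL hη, ← missProb_eq hR hs hL, ← Real.exp_add] at h
  change Real.exp (-L * g t) - Real.exp (-L * g t₀)
    - Real.exp (-(t + δ - t) * (L * β) + -L * g (t + δ)) ≤ _ at h
  have f1 : Real.exp (-L * g t₀) = Real.exp (-L * g t) * Real.exp (-L * (g t₀ - g t)) := by
    rw [← Real.exp_add]; ring_nf
  have f2 : Real.exp (-(t + δ - t) * (L * β) + -L * g (t + δ))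
      = Real.exp (-L * g t) * Real.exp (-L * (g (t + δ) + δ * β - g t)) := by
    rw [← Real.exp_add]; ring_nf
  have f3 : Real.exp (-L * c) * Real.exp (t * (L * β))
      = Real.exp (-L * g t) * Real.exp (-L * (c - (g t + t * β))) := by
    rw [← Real.exp_add, ← Real.exp_add]; ring_nf
  rw [f1, f2] at h
  have hp := Real.exp_pos (-L * g t)
  refine le_of_mul_le_mul_right ?_ (Real.exp_pos (t * (L * β)))
  rw [f3]
  nlinarith [mul_lt_mul_of_pos_left e1 hp, mul_lt_mul_of_pos_left e2 hp,
    mul_lt_mul_of_pos_left e3 hp]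

/-- If `t₀` maximises the Chernoff exponent over `t ≥ 0`, the exponent at `t₀` is the exact decay
rate of the miss-detection probability: every larger rate `c` eventually gives a lower bound. The
maximum is expressed by the first-order conditions `hslope` and `hcompl`. -/
theorem eventually_exp_le_missProb {γ t₀ c : ℝ} (ht₀ : 0 ≤ t₀) (hγ : 0 < γ)
    (h2 : 0 < 1 - 2 * γ * t₀) {N_R N_s : ℕ} (hR : 1 ≤ N_R) (hs : 2 ≤ N_s) {η : ℝ} (hη : 0 ≤ η)
    (hslope : chernoffSlope N_R (N_R * ((N_s : ℝ) - 1)) γ η t₀ ≤ 0)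
    (hcompl : t₀ * chernoffSlope N_R (N_R * ((N_s : ℝ) - 1)) γ η t₀ = 0)
    (hc : chernoffExponent N_R (N_R * ((N_s : ℝ) - 1)) γ η t₀ < c) :
    ∀ᶠ L : ℕ in atTop, Real.exp (-L * c) ≤ missProb N_R N_s γ L η := by
  have hs' : (2 : ℝ) ≤ N_s := by exact_mod_cast hs
  have hR' : (0 : ℝ) < N_R := by exact_mod_cast hR
  have hb : 0 ≤ (N_R : ℝ) * ((N_s : ℝ) - 1) := mul_nonneg hR'.le (by linarith)
  have a0 : 0 < 1 + 2 * t₀ := by positivity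
  have hder := hasDerivAt_chernoffExponent (a := N_R) (b := N_R * ((N_s : ℝ) - 1)) (η := η) a0 h2
  have htan := fun {t : ℝ} => chernoffExponent_lt_tangent (t := t) hR' hb hη a0 h2
  set g := chernoffExponent N_R (N_R * ((N_s : ℝ) - 1)) γ η
  set D := chernoffSlope N_R (N_R * ((N_s : ℝ) - 1)) γ η t₀
  -- Difference quotients to the right of `t₀`, at steps `δ` and `2 δ`.
  have q1 : Tendsto (fun δ => (g (t₀ + δ) - g t₀) / δ) (𝓝[>] 0) (𝓝 D) := by
    have := hder.tendsto_slope_zero_right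
    simpa [div_eq_inv_mul] using this
  have q2 : Tendsto (fun δ => (g (t₀ + 2 * δ) - g t₀) / δ) (𝓝[>] 0) (𝓝 (2 * D)) := by
    have hlim : Tendsto (fun δ : ℝ => 2 * δ) (𝓝[>] 0) (𝓝[>] 0) := by
      refine tendsto_nhdsWithin_iff.mpr ⟨?_, ?_⟩
      · have : Tendsto (fun δ : ℝ => 2 * δ) (𝓝 0) (𝓝 (2 * 0)) :=
          (continuous_const.mul continuous_id).tendsto 0
        rw [mul_zero] at this
        exact this.mono_left nhdsWithin_le_nhds
      · filter_upwards [self_mem_nhdsWithin] with δ hδ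
        exact mul_pos two_pos (Set.mem_Ioi.mp hδ)
    have := (q1.comp hlim).const_mul 2
    refine this.congr' ?_
    filter_upwards [self_mem_nhdsWithin] with δ hδ
    have : δ ≠ 0 := (Set.mem_Ioi.mp hδ).ne'
    simp only [Function.comp_apply]
    field_simp
  have hid : Tendsto (fun δ : ℝ => δ) (𝓝[>] 0) (𝓝 0) := nhdsWithin_le_nhds
  have hg : Tendsto (fun δ => g (t₀ + δ)) (𝓝[>] 0) (𝓝 (g t₀)) := by
    have : Tendsto (fun δ : ℝ => t₀ + δ) (𝓝[>] 0) (𝓝 t₀) := by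
      simpa using hid.const_add t₀
    exact hder.continuousAt.tendsto.comp this
  -- The window `β` is taken just above minus the slope of the chord from `t₀ + δ` to `t₀ + 2 δ`.
  have hB : Tendsto (fun δ => (t₀ + δ) * ((g (t₀ + δ) - g t₀) / δ - (g (t₀ + 2 * δ) - g t₀) / δ + δ)
      + g (t₀ + δ)) (𝓝[>] 0) (𝓝 (g t₀)) := by
    have := ((hid.const_add t₀).mul ((q1.sub q2).add hid)).add hg
    have e : (t₀ + 0) * (D - 2 * D + 0) + g t₀ = g t₀ := by linear_combination -hcompl
    rwa [e] at this
  have hdom : ∀ᶠ δ : ℝ in 𝓝[>] 0, 0 < 1 - 2 * γ * (t₀ + 2 * δ) := by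
    have : Tendsto (fun δ : ℝ => 1 - 2 * γ * (t₀ + 2 * δ)) (𝓝[>] 0)
        (𝓝 (1 - 2 * γ * (t₀ + 2 * 0))) :=
      (((hid.const_mul 2).const_add t₀).const_mul (2 * γ)).const_sub 1
    exact this.eventually (lt_mem_nhds (by simpa using h2))
  obtain ⟨δ, hδ, hBδ, hdomδ⟩ := (Eventually.and (self_mem_nhdsWithin (s := Set.Ioi (0 : ℝ)))
    ((hB.eventually (gt_mem_nhds hc)).and hdom)).exists
  have hδ : 0 < δ := hδ
  have e2 : t₀ + δ + δ = t₀ + 2 * δ := by ring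
  refine eventually_exp_le_missProb_of_lt (t := t₀ + δ) (δ := δ)
    (β := (g (t₀ + δ) - g t₀) / δ - (g (t₀ + 2 * δ) - g t₀) / δ + δ) ht₀ (by linarith) hδ.le hγ
    (by rwa [e2]) hR hs hη ?_ ?_ ?_
  · have hlt := htan (t := t₀ + δ) (by positivity) (by nlinarith [mul_pos hγ hδ]) (by linarith)
    have : (t₀ + δ - t₀) * D ≤ 0 := mul_nonpos_of_nonneg_of_nonpos (by linarith) hslope
    linarith
  · rw [e2]
    change g (t₀ + δ) < g (t₀ + 2 * δ) + _
    have : δ * ((g (t₀ + δ) - g t₀) / δ - (g (t₀ + 2 * δ) - g t₀) / δ + δ)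
        = g (t₀ + δ) - g (t₀ + 2 * δ) + δ * δ := by
      field_simp
      ring
    rw [this]
    nlinarith [mul_pos hδ hδ]
  · change g (t₀ + δ) + _ < c
    linarith

/-! ### The optimal exponent -/

/-- The stationary point of the Chernoff exponent, which may be negative. -/
noncomputable def chernoffPoint (N_R N_s : ℕ) (η γ : ℝ) : ℝ :=
  ((N_R + rateX N_R N_s η γ) / (γ * rateV N_R N_s η γ) - 1) / 2

theorem rateV_pos {N_R N_s : ℕ} {η γ : ℝ} (hR : 1 ≤ N_R) (hs : 2 ≤ N_s) (hη : 0 ≤ η)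
    (hγ : 0 < γ) : 0 < rateV N_R N_s η γ := by
  have hs' : (0 : ℝ) < (N_s : ℝ) - 1 := by
    have : (2 : ℝ) ≤ N_s := by exact_mod_cast hs
    linarith
  have := rateX_pos hR (by omega : 1 ≤ N_s) hη hγ
  unfold rateV
  positivity

theorem rateX_sq {N_R N_s : ℕ} {η γ : ℝ} (hs : 2 ≤ N_s) (hη : 0 ≤ η) (hγ : 0 < γ) :
    rateX N_R N_s η γ ^ 2 = (N_R : ℝ) ^ 2 + γ * η * rateV N_R N_s η γ := by
  have h := rateX_quadratic (N_R := N_R) (by omega : 1 ≤ N_s) hη hγ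
  have h2 : γ + 1 ≠ 0 := by positivity
  unfold rateV
  field_simp
  linear_combination h

theorem one_add_chernoffPoint (N_R N_s : ℕ) (η γ : ℝ) :
    1 + 2 * chernoffPoint N_R N_s η γ
      = (N_R + rateX N_R N_s η γ) / (γ * rateV N_R N_s η γ) := by
  unfold chernoffPoint
  ring

theorem one_sub_chernoffPoint {N_R N_s : ℕ} {η γ : ℝ} (hR : 1 ≤ N_R) (hs : 2 ≤ N_s)
    (hη : 0 ≤ η) (hγ : 0 < γ) :
    1 - 2 * γ * chernoffPoint N_R N_s η γ
      = 2 * N_R * ((N_s : ℝ) - 1) / rateV N_R N_s η γ := by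
  have hv := rateV_pos hR hs hη hγ
  have hvdef : (γ + 1) * rateV N_R N_s η γ
      = rateX N_R N_s η γ + N_R + 2 * N_R * ((N_s : ℝ) - 1) := by
    unfold rateV
    field_simp
  unfold chernoffPoint
  field_simp
  linear_combination hvdef

theorem one_add_chernoffPoint_pos {N_R N_s : ℕ} {η γ : ℝ} (hR : 1 ≤ N_R) (hs : 2 ≤ N_s)
    (hη : 0 ≤ η) (hγ : 0 < γ) : 0 < 1 + 2 * chernoffPoint N_R N_s η γ := by
  have hv := rateV_pos hR hs hη hγ
  have hx := rateX_pos hR (by omega : 1 ≤ N_s) hη hγ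
  rw [one_add_chernoffPoint]
  positivity

theorem one_sub_chernoffPoint_pos {N_R N_s : ℕ} {η γ : ℝ} (hR : 1 ≤ N_R) (hs : 2 ≤ N_s)
    (hη : 0 ≤ η) (hγ : 0 < γ) : 0 < 1 - 2 * γ * chernoffPoint N_R N_s η γ := by
  have hv := rateV_pos hR hs hη hγ
  have hs' : (0 : ℝ) < (N_s : ℝ) - 1 := by
    have : (2 : ℝ) ≤ N_s := by exact_mod_cast hs
    linarith
  rw [one_sub_chernoffPoint hR hs hη hγ]
  positivity

theorem chernoffSlope_chernoffPoint {N_R N_s : ℕ} {η γ : ℝ} (hR : 1 ≤ N_R) (hs : 2 ≤ N_s)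
    (hη : 0 ≤ η) (hγ : 0 < γ) :
    chernoffSlope N_R (N_R * ((N_s : ℝ) - 1)) γ η (chernoffPoint N_R N_s η γ) = 0 := by
  have hv := rateV_pos hR hs hη hγ
  have hx := rateX_pos hR (by omega : 1 ≤ N_s) hη hγ
  have hsq := rateX_sq (N_R := N_R) hs hη hγ
  have hs' : (0 : ℝ) < (N_s : ℝ) - 1 := by
    have : (2 : ℝ) ≤ N_s := by exact_mod_cast hs
    linarith
  have hR' : (0 : ℝ) < N_R := by exact_mod_cast hR
  rw [chernoffSlope, one_add_chernoffPoint, one_sub_chernoffPoint hR hs hη hγ]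
  generalize rateX N_R N_s η γ = x at *
  generalize rateV N_R N_s η γ = v at *
  generalize (N_s : ℝ) - 1 = k at *
  field_simp
  linear_combination -γ * v * hsq

/-- The rate function is the value of the Chernoff exponent at its stationary point. -/
theorem chernoffExponent_chernoffPoint {N_R N_s : ℕ} {η γ : ℝ} (hR : 1 ≤ N_R) (hs : 2 ≤ N_s)
    (hη : 0 ≤ η) (hγ : 0 < γ) :
    chernoffExponent N_R (N_R * ((N_s : ℝ) - 1)) γ η (chernoffPoint N_R N_s η γ)
      = rateFunction N_R N_s η γ := by
  have hv := rateV_pos hR hs hη hγ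
  have hx := rateX_pos hR (by omega : 1 ≤ N_s) hη hγ
  have hR' : (0 : ℝ) < N_R := by exact_mod_cast hR
  have hfrac : chernoffPoint N_R N_s η γ / (1 + 2 * chernoffPoint N_R N_s η γ)
      = (1 - γ * rateV N_R N_s η γ / (N_R + rateX N_R N_s η γ)) / 2 := by
    rw [one_add_chernoffPoint]
    unfold chernoffPoint
    field_simp
  rw [chernoffExponent, hfrac, rateFunction, ← rateX_sq hs hη hγ, Real.sqrt_sq hx.le,
    one_sub_chernoffPoint hR hs hη hγ, one_add_chernoffPoint,
    ← inv_div (γ * rateV N_R N_s η γ), Real.log_inv]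
  ring

theorem chernoffExponent_le_rateFunction {N_R N_s : ℕ} {η γ t : ℝ} (hR : 1 ≤ N_R) (hs : 2 ≤ N_s)
    (hη : 0 ≤ η) (hγ : 0 < γ) (h1 : 0 < 1 + 2 * t) (h2 : 0 < 1 - 2 * γ * t) :
    chernoffExponent N_R (N_R * ((N_s : ℝ) - 1)) γ η t ≤ rateFunction N_R N_s η γ := by
  have hs' : (0 : ℝ) < (N_s : ℝ) - 1 := by
    have : (2 : ℝ) ≤ N_s := by exact_mod_cast hs
    linarith
  have hR' : (0 : ℝ) < N_R := by exact_mod_cast hR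
  rw [← chernoffExponent_chernoffPoint hR hs hη hγ]
  by_cases h : t = chernoffPoint N_R N_s η γ
  · rw [h]
  · have := chernoffExponent_lt_tangent (b := N_R * ((N_s : ℝ) - 1)) hR' (by positivity) hη
      (one_add_chernoffPoint_pos hR hs hη hγ) (one_sub_chernoffPoint_pos hR hs hη hγ) h1 h2 h
    rw [chernoffSlope_chernoffPoint hR hs hη hγ, mul_zero, add_zero] at this
    exact this.le

/-- The first-order conditions for a maximum over `t ≥ 0` can be met: at the stationary point if
it is nonnegative, and at `0` otherwise. -/
theorem exists_chernoffSlope_nonpos {N_R N_s : ℕ} {η γ : ℝ} (hR : 1 ≤ N_R) (hs : 2 ≤ N_s)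
    (hη : 0 ≤ η) (hγ : 0 < γ) :
    ∃ t, 0 ≤ t ∧ 0 < 1 - 2 * γ * t ∧
      chernoffSlope N_R (N_R * ((N_s : ℝ) - 1)) γ η t ≤ 0 ∧
      t * chernoffSlope N_R (N_R * ((N_s : ℝ) - 1)) γ η t = 0 := by
  have hs' : (0 : ℝ) < (N_s : ℝ) - 1 := by
    have : (2 : ℝ) ≤ N_s := by exact_mod_cast hs
    linarith
  have h0 := chernoffSlope_chernoffPoint hR hs hη hγ
  rcases le_total 0 (chernoffPoint N_R N_s η γ) with h | h
  · exact ⟨_, h, one_sub_chernoffPoint_pos hR hs hη hγ, h0.le, by rw [h0, mul_zero]⟩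
  · refine ⟨0, le_rfl, by simp, ?_, zero_mul _⟩
    exact (chernoffSlope_antitone (by positivity) (by positivity) hγ hη
      (one_add_chernoffPoint_pos hR hs hη hγ) (by simp) h).trans_eq h0

theorem chernoffExponent_le_of_slope {a b γ η s t : ℝ} (ha : 0 < a) (hb : 0 ≤ b) (hη : 0 ≤ η)
    (hs0 : 0 ≤ s) (hs2 : 0 < 1 - 2 * γ * s) (hslope : chernoffSlope a b γ η s ≤ 0)
    (hcompl : s * chernoffSlope a b γ η s = 0) (ht0 : 0 ≤ t) (ht2 : 0 < 1 - 2 * γ * t) :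
    chernoffExponent a b γ η t ≤ chernoffExponent a b γ η s := by
  by_cases h : t = s
  · rw [h]
  · have h1 := chernoffExponent_lt_tangent ha hb hη (by positivity) hs2 (by positivity) ht2 h
    have h2 := mul_nonpos_of_nonneg_of_nonpos ht0 hslope
    linarith

/-! ### Averaging over the noncentrality -/

theorem integrable_missProb {Φ : Type*} [MeasurableSpace Φ] {ν : Measure Φ}
    [IsProbabilityMeasure ν] {e : Φ → ℝ} (he : Measurable e) (N_R N_s : ℕ) (γ : ℝ) (L : ℕ) :
    Integrable (fun φ => missProb N_R N_s γ L (e φ)) ν := by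
  have hF : ∀ η, IsProbabilityMeasure (noncentralF (2 * N_R * L) (2 * N_R * L * (N_s - 1)) η) :=
    fun η => Measure.isProbabilityMeasure_map (by fun_prop)
  refine Integrable.of_bound ((measurable_missProb N_R N_s γ L).comp he).aestronglyMeasurable 1
    (ae_of_all _ fun φ => ?_)
  rw [Real.norm_of_nonneg (missProb_nonneg ..)]
  exact measureReal_le_one

/-- The decay rate of a mixture of miss-detection probabilities is the optimal Chernoff exponent at
the essential infimum of the noncentrality. -/
theorem exists_tendsto_log_integral_missProb {Φ : Type*} [MeasurableSpace Φ] {ν : Measure Φ}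
    [IsProbabilityMeasure ν] {e : Φ → ℝ} (he : Measurable e) (he0 : ∀ᵐ φ ∂ν, 0 ≤ e φ)
    {N_R N_s : ℕ} (hR : 1 ≤ N_R) (hs : 2 ≤ N_s) {γ : ℝ} (hγ : 0 < γ) {ηm : ℝ}
    (hηm : ∃ᵐ φ ∂ν, e φ ≤ ηm) :
    ∃ ℓ : ℝ, Tendsto
        (fun L : ℕ => -(1 / (L : ℝ)) * Real.log (∫ φ, missProb N_R N_s γ L (e φ) ∂ν))
        atTop (𝓝 ℓ) ∧ ℓ ≤ rateFunction N_R N_s ηm γ := by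
  have hR' : (0 : ℝ) < N_R := by exact_mod_cast hR
  have hs' : (0 : ℝ) < (N_s : ℝ) - 1 := by
    have : (2 : ℝ) ≤ N_s := by exact_mod_cast hs
    linarith
  have hbdd : IsBoundedUnder (· ≥ ·) (ae ν) e := ⟨0, by simpa using he0⟩
  have hcobdd : IsCoboundedUnder (· ≥ ·) (ae ν) e :=
    IsCoboundedUnder.of_frequently_le hηm
  set η₀ := essInf e ν
  have hη₀ : 0 ≤ η₀ := le_liminf_of_le hcobdd he0
  have hη₀m : η₀ ≤ ηm := liminf_le_of_frequently_le hηm hbdd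
  have hge : ∀ᵐ φ ∂ν, η₀ ≤ e φ := ae_essInf_le hbdd
  obtain ⟨t, ht, ht2, hslope, hcompl⟩ := exists_chernoffSlope_nonpos hR hs hη₀ hγ
  set ℓ := chernoffExponent N_R (N_R * ((N_s : ℝ) - 1)) γ η₀ t
  set I : ℕ → ℝ := fun L => ∫ φ, missProb N_R N_s γ L (e φ) ∂ν
  have hupper : ∀ L : ℕ, 1 ≤ L → I L ≤ Real.exp (-L * ℓ) := by
    intro L hL
    have : I L ≤ ∫ _, Real.exp (-L * ℓ) ∂ν := by
      refine integral_mono_ae (integrable_missProb he ..) (integrable_const _) ?_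
      filter_upwards [hge] with φ hφ
      refine (missProb_le ht ht2 hR hs hL (hη₀.trans hφ)).trans (Real.exp_le_exp.mpr ?_)
      have := mul_le_mul_of_nonneg_left (chernoffExponent_mono (a := N_R)
        (b := N_R * ((N_s : ℝ) - 1)) (γ := γ) ht hφ) (Nat.cast_nonneg (α := ℝ) L)
      linarith
    simpa using this
  have hlower : ∀ c, ℓ < c → ∃ κ > 0, ∀ᶠ L : ℕ in atTop, κ * Real.exp (-L * c) ≤ I L := by
    intro c hc
    have hfreq : ∃ᵐ φ ∂ν, e φ < η₀ + (c - ℓ) :=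
      frequently_lt_of_liminf_lt hcobdd (by change η₀ < _; linarith)
    have hpoint : ∃ᵐ φ ∂ν, ∃ N : ℕ, ∀ L ≥ N, Real.exp (-L * c) ≤ missProb N_R N_s γ L (e φ) := by
      refine (hfreq.and_eventually hge).mono fun φ ⟨h1, h2⟩ => eventually_atTop.mp ?_
      have hφ := hη₀.trans h2
      obtain ⟨s, hs0, hs2, hsl, hscompl⟩ := exists_chernoffSlope_nonpos hR hs hφ hγ
      refine eventually_exp_le_missProb hs0 hγ hs2 hR hs hφ hsl hscompl ?_
      have b1 := chernoffExponent_le_add (a := N_R) (b := N_R * ((N_s : ℝ) - 1)) (γ := γ) hs0 h2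
      have b2 : _ ≤ ℓ := chernoffExponent_le_of_slope hR' (by positivity) hη₀ ht ht2 hslope hcompl
        hs0 hs2
      linarith
    -- Some threshold `N` works on a set of positive measure.
    obtain ⟨N, hN⟩ : ∃ N : ℕ,
        ν {φ | ∀ L ≥ N, Real.exp (-L * c) ≤ missProb N_R N_s γ L (e φ)} ≠ 0 := by
      by_contra! hcon
      refine hpoint (measure_mono_null ?_ (measure_iUnion_null hcon))
      intro φ hφ
      simpa using hφ
    refine ⟨ν.real {φ | ∀ L ≥ N, Real.exp (-L * c) ≤ missProb N_R N_s γ L (e φ)},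
      ENNReal.toReal_pos hN (measure_ne_top _ _), ?_⟩
    filter_upwards [eventually_ge_atTop N] with L hL
    have h := mul_meas_ge_le_integral_of_nonneg
      (ae_of_all ν fun φ => missProb_nonneg N_R N_s γ L (e φ)) (integrable_missProb he ..)
      (Real.exp (-L * c))
    refine le_trans ?_ h
    rw [mul_comm]
    gcongr
    · exact measure_ne_top _ _
    · exact fun hφ => hφ L hL
  refine ⟨ℓ, ?_, (chernoffExponent_mono ht hη₀m).trans
    (chernoffExponent_le_rateFunction hR hs (hη₀.trans hη₀m) hγ (by positivity) ht2)⟩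
  refine tendsto_order.mpr ⟨fun d hd => ?_, fun d hd => ?_⟩
  · obtain ⟨κ, hκ, hev⟩ := hlower (ℓ + 1) (by linarith)
    filter_upwards [hev, eventually_ge_atTop 1] with L h1 hL
    have hL' : (0 : ℝ) < L := by exact_mod_cast hL
    have hpos : 0 < I L := lt_of_lt_of_le (by positivity) h1
    have hlog := Real.log_le_log hpos (hupper L hL)
    rw [Real.log_exp] at hlog
    refine hd.trans_le ?_
    rw [neg_mul, one_div_mul_eq_div, ← neg_div, le_div_iff₀ hL']
    linarith
  · obtain ⟨c, hc1, hc2⟩ := exists_between hd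
    obtain ⟨κ, hκ, hev⟩ := hlower c hc1
    have hlim : Tendsto (fun L : ℕ => c - Real.log κ / L) atTop (𝓝 (c - 0)) :=
      (tendsto_const_div_atTop_nhds_zero_nat _).const_sub c
    rw [sub_zero] at hlim
    filter_upwards [hev, eventually_ge_atTop 1, hlim.eventually (gt_mem_nhds hc2)] with L h1 hL h3
    have hL' : (0 : ℝ) < L := by exact_mod_cast hL
    have hlog := Real.log_le_log (by positivity) h1
    rw [Real.log_mul hκ.ne' (Real.exp_pos _).ne', Real.log_exp] at hlog
    refine lt_of_le_of_lt ?_ h3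
    have e : c - Real.log κ / L = (L * c - Real.log κ) / L := by field_simp
    rw [e, neg_mul, one_div_mul_eq_div, ← neg_div]
    gcongr
    linarith

theorem measurable_eta {Φ : Type*} [MeasurableSpace Φ] {J : ℕ} (N_R N_s : ℕ) (P_T σ : ℝ)
    {α : Φ → ℝ} (hα : Measurable α) {Gj : Fin J → Φ → ℝ} (hG : ∀ j, Measurable (Gj j)) :
    Measurable (eta N_R N_s P_T σ α Gj) := by
  unfold eta avgGain
  fun_prop

end BSDiscovery

theorem proposition4
    {Φ : Type*} [MeasurableSpace Φ] (μ : MeasureTheory.Measure Φ)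
    (Ω : Set Φ) (hΩ : MeasurableSet Ω)
    (p : Φ → ℝ) (hp_int : MeasureTheory.IntegrableOn p Ω μ) (hp_nonneg : ∀ φ ∈ Ω, 0 ≤ p φ)
    (hp_one : ∫ φ in Ω, p φ ∂μ = 1)
    (N_R N_s J : ℕ) (hN_R : 1 ≤ N_R) (hN_s : 2 ≤ N_s) (hJ : 1 ≤ J)
    (P_T σ γ : ℝ) (hP_T : 0 < P_T) (hσ : 0 < σ) (hγ : 0 < γ)
    (α : Φ → ℝ) (hα_meas : Measurable α) (hα_pos : ∀ φ ∈ Ω, 0 < α φ)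
    (Gj : Fin J → Φ → ℝ) (hG_meas : ∀ j, Measurable (Gj j))
    (hG_nonneg : ∀ j, ∀ φ ∈ Ω, 0 ≤ Gj j φ)
    (Ωm : Set Φ) (hΩm : MeasurableSet Ωm) (hΩm_sub : Ωm ⊆ Ω)
    (ηm : ℝ) (hηm : ∀ φ ∈ Ωm, BSDiscovery.eta N_R N_s P_T σ α Gj φ ≤ ηm)
    (hΩm_pos : 0 < ∫ φ in Ωm, p φ ∂μ)
    (hγ_lt : γ < (2 * N_R + ηm) / (2 * N_R * ((N_s : ℝ) - 1))) :
    ∃ ℓ : ℝ,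
      Filter.Tendsto
        (fun L : ℕ => -(1 / (L : ℝ)) * Real.log
          (BSDiscovery.avgMissProb μ Ω p N_R N_s γ (BSDiscovery.eta N_R N_s P_T σ α Gj) L))
        Filter.atTop (nhds ℓ) ∧
      ℓ ≤ BSDiscovery.rateFunction N_R N_s ηm γ := by
  open MeasureTheory in
  -- The law of the direction.
  set ν : Measure Φ := (μ.restrict Ω).withDensity fun φ => ENNReal.ofReal (p φ) with hν
  have hp_ae : 0 ≤ᵐ[μ.restrict Ω] p := (ae_restrict_iff' hΩ).mpr (ae_of_all _ hp_nonneg)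
  have hdens : AEMeasurable (fun φ => ENNReal.ofReal (p φ)) (μ.restrict Ω) :=
    hp_int.aestronglyMeasurable.aemeasurable.ennreal_ofReal
  have hprob : IsProbabilityMeasure ν := by
    refine ⟨?_⟩
    rw [hν, withDensity_apply _ MeasurableSet.univ, Measure.restrict_univ,
      ← ofReal_integral_eq_lintegral_ofReal hp_int hp_ae, hp_one, ENNReal.ofReal_one]
  have havg : ∀ L, BSDiscovery.avgMissProb μ Ω p N_R N_s γ (BSDiscovery.eta N_R N_s P_T σ α Gj) L
      = ∫ φ, BSDiscovery.missProb N_R N_s γ L (BSDiscovery.eta N_R N_s P_T σ α Gj φ) ∂ν := by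
    intro L
    rw [BSDiscovery.avgMissProb, hν, integral_withDensity_eq_integral_toReal_smul₀ hdens
      (ae_of_all _ fun _ => ENNReal.ofReal_lt_top)]
    refine integral_congr_ae ?_
    filter_upwards [hp_ae] with φ hφ
    rw [ENNReal.toReal_ofReal hφ, smul_eq_mul, mul_comm]
  have hη0 : ∀ᵐ φ ∂ν, 0 ≤ BSDiscovery.eta N_R N_s P_T σ α Gj φ := by
    refine (withDensity_absolutelyContinuous _ _).ae_le ?_
    filter_upwards [ae_restrict_mem hΩ] with φ hφ
    have h1 := hα_pos φ hφ
    have h2 : 0 ≤ ∑ j, Gj j φ := Finset.sum_nonneg fun j _ => hG_nonneg j φ hφ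
    unfold BSDiscovery.eta BSDiscovery.avgGain
    positivity
  have hfreq : ∃ᵐ φ ∂ν, BSDiscovery.eta N_R N_s P_T σ α Gj φ ≤ ηm := by
    intro hcon
    have hnull : ν Ωm = 0 := measure_mono_null (fun φ hφ => not_not.mpr (hηm φ hφ)) hcon
    have hsub : μ.restrict Ωm ≤ μ.restrict Ω := Measure.restrict_mono hΩm_sub le_rfl
    rw [hν, withDensity_apply _ hΩm, Measure.restrict_restrict hΩm,
      Set.inter_eq_left.mpr hΩm_sub, ← ofReal_integral_eq_lintegral_ofReal
        (hp_int.mono_set hΩm_sub) (hsub.absolutelyContinuous.ae_le hp_ae),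
      ENNReal.ofReal_eq_zero] at hnull
    linarith
  simp only [havg]
  exact BSDiscovery.exists_tendsto_log_integral_missProb
    (BSDiscovery.measurable_eta N_R N_s P_T σ hα_meas hG_meas) hη0 hN_R hN_s hγ hfreq
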